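/- Let $d\ge 2$, let $S$ be a finite set and $\Omega=S^{\mathbb Z^d}$ with the product $\sigma$-algebra $\mathfrak B$ and the distance $d(\omega,\omega')=2^{-k}$, $k=\min\{\|x\|_\infty:\omega_x\ne\omega'_x\}$ (and $d(\omega,\omega)=0$). Let $(T_x\omega)_y=\omega_{y-x}$ be the shift. Let $\Phi(\Lambda,\omega)\in\mathbb R$ ($\Lambda\subset\mathbb Z^d$ finite, $\omega\in\Omega$) be a uniformly summable, shift-invariant potential: $\Phi(\Lambda,\cdot)$ is measurable with respect to the $\sigma$-algebra generated by the coordinates in $\Lambda$, $\Phi(\Lambda+x,T_x\omega)=\Phi(\Lambda,\omega)$, and $\sum_{\Lambda\ni 0}\|\Phi(\Lambda,\cdot)\|_\infty<\infty$. Its specification is $$\gamma^\Phi_\Lambda(\sigma\,|\,\eta)=\frac{1}{Z_\Lambda(\eta)}\exp\Big(-\sum_{\Lambda'\cap\Lambda\neq\emptyset}\Phi(\Lambda',\sigma_\Lambda\eta_{\Lambda^c})\Big),\qquad \sigma\in S^\Lambda,\ \eta\in\Omega,$$ where $Z_\Lambda(\eta)$ is the normalizing factor. A Gibbs measure for $\Phi$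 is a probability measure $\mu$ on $(\Omega,\mathfrak B)$ such that $\mu(A)=\int\sum_{\sigma\in S^\Lambda}\gamma^\Phi_\Lambda(\sigma|\eta)\,\mathbf 1_A(\sigma_\Lambda\eta_{\Lambda^c})\,d\mu(\eta)$ for all $A\in\mathfrak B$ and all finite $\Lambda$. Put $$C_{x,y}=\sup_{\omega,\omega'\in\Omega:\ \omega_z=\omega'_z\ \forall z\ne y}\ \ \sup_{A\subset S}\big|\gamma^\Phi_{\{x\}}(A|\omega)-\gamma^\Phi_{\{x\}}(A|\omega')\big|,\qquad \mathfrak c=\sum_{x\in\mathbb Z^d}C_{0,x},$$ and assume Dobrushin's uniqueness condition $\mathfrak c<1$. Let $\mu_\Phi$ be the Gibbs measure for $\Phi$. For a nonempty finite $\Lambda\subset\mathbb Z^d$ let $\mathcal E_\Lambda(\omega)=\frac1{|\Lambda|}\sum_{x\in\Lambda}\delta_{T_x\omega}$ be the empirical measure, and let $d_K(\mu_1,\mu_2)=\sup_G\big(\int G\,d\mu_1-\int G\,d\mu_2\big)$ be the Kantorovich distance, the supremum being over all $G:\Omega\to\mathbb R$ with $|G(\omega)-G(\eta)|\le d(\omega,\eta)$.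 Then, for every nonempty finite $\Lambda\subset\mathbb Z^d$, the function $\omega\mapsto d_K(\mathcal E_\Lambda(\omega),\mu_\Phi)$ is $\mu_\Phi$-integrable, and for every $u>0$ $$\mu_\Phi\Big\{\omega\in\Omega:\ \Big|d_K(\mathcal E_\Lambda(\omega),\mu_\Phi)-\mathbb E_{\mu_\Phi}\big[d_K(\mathcal E_\Lambda(\cdot),\mu_\Phi)\big]\Big|\ge u\Big\}\le 2\exp\big(-c\,|\Lambda|\,u^2\big),$$ where $$c=\frac{(1-\mathfrak c)^2}{2c_d},\qquad c_d=\Big(\sum_{z\in\mathbb Z^d}2^{-\|z\|_\infty}\Big)^2 .$$ -/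

import Mathlib

open MeasureTheory
open scoped ENNReal

noncomputable section

namespace LatticeGibbs

/-- Sites of the lattice `ℤ^d`. -/
abbrev Site (d : ℕ) : Type := Fin d → ℤ

/-- Configurations `S^{ℤ^d}`; as a product it carries the product σ-algebra, generated by the
coordinate maps. -/
abbrev Config (d : ℕ) (S : Type*) : Type _ := Site d → S

variable {d : ℕ} {S : Type*}

/-- `‖x‖_∞ = max_i |x_i|`. -/
def supNorm (x : Site d) : ℕ := Finset.univ.sup fun i => (x i).natAbs

open Classical in
/-- `d(ω, ω') = 2^{-k}` with `k = min {‖x‖_∞ : ω_x ≠ ω'_x}`, and `d(ω, ω) = 0`. -/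
def configDist (ω ω' : Config d S) : ℝ :=
  if ω = ω' then 0 else (1 / 2 : ℝ) ^ sInf {k : ℕ | ∃ x, ω x ≠ ω' x ∧ supNorm x = k}

/-- The shift `(T_x ω)_y = ω_{y - x}`. -/
def shift (x : Site d) (ω : Config d S) : Config d S := fun y => ω (y - x)

/-- The configuration `σ_Λ η_{Λᶜ}`. -/
def glue (Λ : Finset (Site d)) (σ : Λ → S) (η : Config d S) : Config d S :=
  fun x => if h : x ∈ Λ then σ ⟨x, h⟩ else η x

/-- Uniformly summable, shift-invariant potentials: `Φ(Λ, ·)` is measurable with respect to the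
σ-algebra generated by the coordinates in `Λ`, `Φ(Λ + x, T_x ω) = Φ(Λ, ω)`, and
`∑_{Λ ∋ 0} ‖Φ(Λ, ·)‖_∞ < ∞`. -/
structure IsUniformlySummablePotential [MeasurableSpace S]
    (Φ : Finset (Site d) → Config d S → ℝ) : Prop where
  measurable : ∀ Λ : Finset (Site d),
    Measurable[cylinderEvents (X := fun _ : Site d => S) (Λ : Set (Site d))] (Φ Λ)
  shift_invariant : ∀ (Λ : Finset (Site d)) (x : Site d) (ω : Config d S),
    Φ (Λ.image fun y => y + x) (shift x ω) = Φ Λ ω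
  summable : Summable fun Λ : {Λ : Finset (Site d) // (0 : Site d) ∈ Λ} =>
    ⨆ ω : Config d S, |Φ Λ.1 ω|

/-- The Hamiltonian `H_Λ(σ | η) = ∑_{Λ' ∩ Λ ≠ ∅} Φ(Λ', σ_Λ η_{Λᶜ})`. -/
def hamiltonian (Φ : Finset (Site d) → Config d S → ℝ) (Λ : Finset (Site d))
    (σ : Λ → S) (η : Config d S) : ℝ :=
  ∑' Λ' : {Λ' : Finset (Site d) // (Λ' ∩ Λ).Nonempty}, Φ Λ'.1 (glue Λ σ η)

/-- The partition function `Z_Λ(η)`. -/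
def partitionFunction [Fintype S] (Φ : Finset (Site d) → Config d S → ℝ) (Λ : Finset (Site d))
    (η : Config d S) : ℝ :=
  ∑ σ : Λ → S, Real.exp (-hamiltonian Φ Λ σ η)

/-- The specification `γ_Λ(σ | η) = exp(-H_Λ(σ | η)) / Z_Λ(η)`. -/
def specification [Fintype S] (Φ : Finset (Site d) → Config d S → ℝ) (Λ : Finset (Site d))
    (σ : Λ → S) (η : Config d S) : ℝ :=
  Real.exp (-hamiltonian Φ Λ σ η) / partitionFunction Φ Λ η

/-- `μ` is a Gibbs measure for `Φ`: a probability measure satisfying the DLR equations. -/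
structure IsGibbsMeasure [Fintype S] [MeasurableSpace S]
    (Φ : Finset (Site d) → Config d S → ℝ) (μ : Measure (Config d S)) : Prop where
  isProbabilityMeasure : IsProbabilityMeasure μ
  dlr : ∀ (Λ : Finset (Site d)) (A : Set (Config d S)), MeasurableSet A →
    μ A = ∫⁻ η, ∑ σ : Λ → S,
      ENNReal.ofReal (specification Φ Λ σ η) * A.indicator 1 (glue Λ σ η) ∂μ

/-- The uniform distance `sup_A |p(A) - q(A)|` (supremum over events) between two probability
vectors on a finite set. -/
def uniformDist {α : Type*} (p q : α → ℝ) : ℝ :=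
  ⨆ A : Finset α, |∑ a ∈ A, p a - ∑ a ∈ A, q a|

/-- The Dobrushin interdependence matrix: `C_{x,y}` is the supremum, over pairs of configurations
which agree off `y`, of the uniform distance between the single-site distributions at `x`. -/
def dobrushinMatrix [Fintype S] (Φ : Finset (Site d) → Config d S → ℝ) (x y : Site d) : ℝ :=
  ⨆ p : {p : Config d S × Config d S // ∀ z, z ≠ y → p.1 z = p.2 z},
    uniformDist (fun σ => specification Φ {x} σ p.1.1) (fun σ => specification Φ {x} σ p.1.2)

/-- `𝔠 = ∑_x C_{0,x}`, as an element of `[0, ∞]`. -/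
def dobrushinCoeff [Fintype S] (Φ : Finset (Site d) → Config d S → ℝ) : ℝ≥0∞ :=
  ∑' x : Site d, ENNReal.ofReal (dobrushinMatrix Φ 0 x)

/-- The empirical measure `|Λ|⁻¹ ∑_{x ∈ Λ} δ_{T_x ω}`. -/
def empiricalMeasure [MeasurableSpace S] (Λ : Finset (Site d)) (ω : Config d S) :
    Measure (Config d S) :=
  (Λ.card : ℝ≥0∞)⁻¹ • ∑ x ∈ Λ, Measure.dirac (shift x ω)

/-- The Kantorovich distance: the supremum of `E_{μ₁}[G] - E_{μ₂}[G]` over all functions `G` that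
are 1-Lipschitz for `configDist`. -/
def kantorovichDist [MeasurableSpace S] (μ₁ μ₂ : Measure (Config d S)) : ℝ :=
  ⨆ G : {G : Config d S → ℝ // ∀ ω η, |G ω - G η| ≤ configDist ω η},
    (∫ ω, G.1 ω ∂μ₁ - ∫ ω, G.1 ω ∂μ₂)

/-- `c_d = (∑_{z ∈ ℤ^d} 2^{-‖z‖_∞})²`. -/
def latticeConst (d : ℕ) : ℝ := (∑' z : Site d, (1 / 2 : ℝ) ^ supNorm z) ^ 2

end LatticeGibbs

end

/-!
The concentration bound is proved by resampling one site at a time, without martingales and without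
conditioning on infinitely many coordinates.

Let `P_x` be the heat-bath update at `x` (`heatBath`), and let `v` bound the oscillations of `g`
(`HasOsc`). Then `P_x g` has oscillations bounded by the vector in which the entry at `x` is replaced
by `0` and the amount `v x * C x y` is added at each site `y` (`hasOsc_heatBath`). As the row sums of
the interdependence matrix are at most `c < 1`, the total oscillation drops by at least
`(1 - c) * v x`, and repeated sweeps over large finite sets bring it below any `ε`
(`exists_tsum_lt`). A function of total oscillation `ε` is within `ε` of its mean.

The DLR equation for one site says that `μ` is invariant under `P_x`. It turns
`∫ (g - P_x g) exp (θ f) dμ` into the average of a conditional covariance at `x`, which is at most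
`θ * v x * a x * ∫ exp (θ f) dμ` when `a` bounds the oscillations of `f`
(`integral_sub_heatBath_mul_exp_le`). Telescoping along a sequence of updates which starts at `f` and
ends near its mean, the costs add up to at most `θ B ∫ exp (θ f) dμ` with
`B = (sup a) * (∑ a) / (1 - c)`, because the cost of each step is proportional to the drop of the
total oscillation (`integral_centered_mul_exp_le`). This is a differential inequality for the moment
generating function; it gives `mgf ≤ exp (B θ² / 2)` for the centered function, and Chernoff's
bound gives `measureReal_abs_ge_le`.

For the Kantorovich distance one may take `a z = |Λ|⁻¹ ∑_{x ∈ Λ} 2^{-‖z + x‖}`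
(`hasOsc_kantorovichDist`), whose sum is `√c_d` and whose supremum is at most `√c_d / |Λ|`. The
resulting exponent has `1 - c` in place of `(1 - c)²`, which is stronger than needed. Uniform
summability of the potential enters only through the quasilocality of the single-site
distributions (`hasOsc_siteProb_zero`).
-/

/-! ### Finite probability vectors -/

/-- If `|p(A) - q(A)| ≤ D` for all events `A`, then the expectations of a function of oscillation at
most `w` differ by at most `D * w`. -/
theorem sum_sub_mul_le_of_event_le {S : Type*} [Fintype S] {p q h : S → ℝ} {D w : ℝ}
    (hpq : ∑ s, p s = ∑ s, q s) (hD : ∀ A : Finset S, |∑ s ∈ A, p s - ∑ s ∈ A, q s| ≤ D)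
    (hw : 0 ≤ w) (hh : ∀ s t, |h s - h t| ≤ w) :
    ∑ s, (p s - q s) * h s ≤ D * w := by
  classical
  have hD0 : 0 ≤ D := by simpa using hD ∅
  rcases isEmpty_or_nonempty S with hS | hS
  · simpa using mul_nonneg hD0 hw
  obtain ⟨s₀, hs₀⟩ := Finite.exists_min h
  have key : ∑ s, (p s - q s) * h s = ∑ s, (p s - q s) * (h s - h s₀) := by
    simp only [mul_sub, Finset.sum_sub_distrib, ← Finset.sum_mul, hpq]
    ring
  calc ∑ s, (p s - q s) * h s = ∑ s, (p s - q s) * (h s - h s₀) := key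
    _ ≤ ∑ s, if q s ≤ p s then (p s - q s) * w else 0 := by
        refine Finset.sum_le_sum fun s _ => ?_
        have h1 : h s - h s₀ ≤ w := (le_abs_self _).trans (hh s s₀)
        have h2 : 0 ≤ h s - h s₀ := sub_nonneg.2 (hs₀ s)
        split_ifs with hs
        · exact mul_le_mul_of_nonneg_left h1 (sub_nonneg.2 hs)
        · exact mul_nonpos_of_nonpos_of_nonneg (by linarith) h2
    _ = (∑ s with q s ≤ p s, p s - ∑ s with q s ≤ p s, q s) * w := by
        rw [← Finset.sum_filter, ← Finset.sum_sub_distrib, Finset.sum_mul]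
    _ ≤ D * w := mul_le_mul_of_nonneg_right ((le_abs_self _).trans (hD _)) hw

/-- The sum on the right is a convenient upper bound for the slope of `exp` between `a` and `b`. -/
theorem abs_exp_sub_exp_le (a b : ℝ) :
    |Real.exp a - Real.exp b| ≤ |a - b| * (Real.exp a + Real.exp b) := by
  have aux : ∀ a b : ℝ, b ≤ a → |Real.exp a - Real.exp b| ≤ |a - b| * (Real.exp a + Real.exp b) := by
    intro a b hab
    have h1 : Real.exp a - Real.exp b = Real.exp a * (1 - Real.exp (b - a)) := by
      rw [mul_sub, ← Real.exp_add]; simp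
    have h2 := Real.add_one_le_exp (b - a)
    rw [abs_of_nonneg (sub_nonneg.2 (Real.exp_le_exp.2 hab)), abs_of_nonneg (sub_nonneg.2 hab), h1]
    nlinarith [Real.exp_pos a, Real.exp_pos b, mul_nonneg (sub_nonneg.2 hab) (Real.exp_pos b).le]
  rcases le_total b a with h | h
  · exact aux a b h
  · rw [abs_sub_comm, abs_sub_comm a, add_comm]
    exact aux b a h

/-- The covariance of `g` and `exp h` under a probability vector is controlled by the product of the
oscillations of `g` and `h`, relative to the expectation of `exp h`. -/
theorem sum_centered_mul_exp_le {S : Type*} [Fintype S] {p g h : S → ℝ} {v w : ℝ}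
    (hp : ∀ s, 0 ≤ p s) (hp1 : ∑ s, p s = 1) (hv : 0 ≤ v)
    (hg : ∀ s t, |g s - g t| ≤ v) (hh : ∀ s t, |h s - h t| ≤ w) :
    ∑ s, p s * ((g s - ∑ t, p t * g t) * Real.exp (h s)) ≤ v * w * ∑ s, p s * Real.exp (h s) := by
  set I := ∑ s, p s * ((g s - ∑ t, p t * g t) * Real.exp (h s)) with hI
  have e1 : I = ∑ s, ∑ t, p s * p t * ((g s - g t) * Real.exp (h s)) := by
    refine Finset.sum_congr rfl fun s _ => ?_
    have : g s - ∑ t, p t * g t = ∑ t, p t * (g s - g t) := by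
      simp only [mul_sub, Finset.sum_sub_distrib, ← Finset.sum_mul, hp1, one_mul]
    rw [this, Finset.sum_mul, Finset.mul_sum]
    exact Finset.sum_congr rfl fun t _ => by ring
  have e2 : I = ∑ s, ∑ t, p s * p t * ((g t - g s) * Real.exp (h t)) := by
    rw [e1, Finset.sum_comm]
    exact Finset.sum_congr rfl fun s _ => Finset.sum_congr rfl fun t _ => by ring
  have e3 : 2 * I = ∑ s, ∑ t, p s * p t * ((g s - g t) * (Real.exp (h s) - Real.exp (h t))) := by
    rw [two_mul]
    nth_rewrite 1 [e1]
    rw [e2]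
    simp only [← Finset.sum_add_distrib]
    exact Finset.sum_congr rfl fun s _ => Finset.sum_congr rfl fun t _ => by ring
  have e4 : 2 * I ≤ ∑ s, ∑ t, p s * p t * (v * w * (Real.exp (h s) + Real.exp (h t))) := by
    rw [e3]
    refine Finset.sum_le_sum fun s _ => Finset.sum_le_sum fun t _ => ?_
    refine mul_le_mul_of_nonneg_left ?_ (mul_nonneg (hp s) (hp t))
    calc (g s - g t) * (Real.exp (h s) - Real.exp (h t))
        ≤ |g s - g t| * |Real.exp (h s) - Real.exp (h t)| := by
          rw [← abs_mul]; exact le_abs_self _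
      _ ≤ v * (w * (Real.exp (h s) + Real.exp (h t))) := by
          refine mul_le_mul (hg s t) ((abs_exp_sub_exp_le _ _).trans ?_) (abs_nonneg _) hv
          exact mul_le_mul_of_nonneg_right (hh s t) (by positivity)
      _ = _ := by ring
  have e5 : ∑ s, ∑ t, p s * p t * (v * w * (Real.exp (h s) + Real.exp (h t)))
      = 2 * (v * w * ∑ s, p s * Real.exp (h s)) := by
    have a1 : ∀ s t, p s * p t * (v * w * (Real.exp (h s) + Real.exp (h t)))
        = v * w * ((p s * Real.exp (h s)) * p t + p s * (p t * Real.exp (h t))) := by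
      intro s t; ring
    simp only [a1, ← Finset.mul_sum, Finset.sum_add_distrib, ← Finset.sum_mul, hp1]
    ring
  linarith

/-! ### Summable oscillation bounds -/

/-- `v` bounds the oscillations of `f` on the product space `ι → S`: the vector `v` is nonnegative
and summable, and changing a configuration changes `f` by at most the sum of `v` over the sites of
disagreement. Infinitely many sites may be changed at once, so this contains the quasilocality of
`f`. -/
structure HasOsc {ι S : Type*} (f : (ι → S) → ℝ) (v : ι → ℝ) : Prop where
  nonneg : ∀ x, 0 ≤ v x
  summable : Summable v
  bound : ∀ ω ω', |f ω - f ω'| ≤ ∑' y, {y | ω y ≠ ω' y}.indicator v y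

namespace HasOsc

variable {ι S : Type*} {f : (ι → S) → ℝ} {v : ι → ℝ}

theorem const (b : ℝ) : HasOsc (fun _ : ι → S => b) 0 :=
  ⟨fun _ => le_rfl, summable_zero, fun _ _ => by simp⟩

theorem neg (hf : HasOsc f v) : HasOsc (fun ω => -f ω) v :=
  ⟨hf.nonneg, hf.summable, fun ω ω' => by
    rw [neg_sub_neg, abs_sub_comm]; exact hf.bound ω ω'⟩

theorem comp_equiv (hf : HasOsc f v) (e : ι ≃ ι) :
    HasOsc (fun ω => f fun z => ω (e z)) fun y => v (e.symm y) := by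
  refine ⟨fun y => hf.nonneg _, e.symm.summable_iff.2 hf.summable, fun ω ω' =>
    (hf.bound _ _).trans (le_of_eq ?_)⟩
  rw [← e.symm.tsum_eq]
  refine tsum_congr fun y => ?_
  by_cases h : ω y = ω' y <;> simp [Set.indicator, h]

theorem abs_sub_le_tsum (hf : HasOsc f v) (ω ω' : ι → S) : |f ω - f ω'| ≤ ∑' y, v y :=
  (hf.bound ω ω').trans <| (hf.summable.indicator _).tsum_le_tsum
    (fun y => Set.indicator_le_self' (fun _ _ => hf.nonneg _) y) hf.summable

theorem abs_sub_update_le [DecidableEq ι] (hf : HasOsc f v) (ω : ι → S) (x : ι) (s t : S) :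
    |f (Function.update ω x s) - f (Function.update ω x t)| ≤ v x := by
  refine (hf.bound _ _).trans ?_
  rw [tsum_eq_single x]
  · exact Set.indicator_le_self' (fun _ _ => hf.nonneg _) x
  · intro y hy
    simp [hy]

/-- A function with summable oscillations is a pointwise limit of functions of finitely many
coordinates. -/
theorem measurable [Countable ι] [Finite S] [MeasurableSpace S] [DiscreteMeasurableSpace S]
    (hf : HasOsc f v) : Measurable f := by
  classical
  rcases isEmpty_or_nonempty (ι → S) with he | ⟨⟨ω₀⟩⟩
  · exact measurable_of_empty f
  -- `F V` evaluates `f` with the coordinates off `V` frozen to those of `ω₀`.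
  let F : Finset ι → (ι → S) → ℝ := fun V ω => f fun y => if y ∈ V then ω y else ω₀ y
  have hF : ∀ V, Measurable (F V) := by
    intro V
    have h1 : Measurable fun τ : V → S => f fun y => if h : y ∈ V then τ ⟨y, h⟩ else ω₀ y :=
      Measurable.of_discrete
    have h2 : Measurable fun (ω : ι → S) (y : V) => ω y :=
      measurable_pi_lambda _ fun y => measurable_pi_apply _
    simpa [Function.comp_def, F] using h1.comp h2
  refine measurable_of_tendsto_metrizable' Filter.atTop hF ?_
  rw [tendsto_pi_nhds]
  intro ω
  rw [tendsto_iff_norm_sub_tendsto_zero]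
  refine squeeze_zero (fun _ => norm_nonneg _) (fun V => ?_) (tendsto_tsum_compl_atTop_zero v)
  rw [Real.norm_eq_abs]
  refine (hf.bound _ _).trans ?_
  have h3 : ∑' a : {x // x ∉ V}, v a = ∑' y, {x | x ∉ V}.indicator v y := tsum_subtype _ v
  rw [h3]
  refine (hf.summable.indicator _).tsum_le_tsum (fun y => ?_) (hf.summable.indicator _)
  refine Set.indicator_le_indicator_of_subset (fun z hz => ?_) hf.nonneg y
  simp only [ne_eq, Set.mem_ofPred_eq] at hz ⊢
  intro hzV
  simp [hzV] at hz

theorem integrable [Countable ι] [Finite S] [MeasurableSpace S] [DiscreteMeasurableSpace S]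
    (hf : HasOsc f v) (μ : Measure (ι → S)) [IsFiniteMeasure μ] : Integrable f μ := by
  rcases isEmpty_or_nonempty (ι → S) with he | ⟨⟨ω₀⟩⟩
  · have : μ = 0 := Measure.eq_zero_of_isEmpty μ
    simp [this]
  refine Integrable.of_bound hf.measurable.aestronglyMeasurable (|f ω₀| + ∑' y, v y)
    (Filter.Eventually.of_forall fun ω => ?_)
  rw [Real.norm_eq_abs]
  have := abs_add_le (f ω₀) (f ω - f ω₀)
  have h2 := hf.abs_sub_le_tsum ω ω₀
  rw [add_sub_cancel] at this
  linarith

theorem abs_sub_integral_le [Countable ι] [Finite S] [MeasurableSpace S]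
    [DiscreteMeasurableSpace S] (hf : HasOsc f v) (μ : Measure (ι → S)) [IsProbabilityMeasure μ]
    (ω : ι → S) : |f ω - ∫ η, f η ∂μ| ≤ ∑' y, v y := by
  have h1 : f ω - ∫ η, f η ∂μ = ∫ η, (f ω - f η) ∂μ := by
    rw [integral_sub (integrable_const _) (hf.integrable μ)]; simp
  rw [h1]
  have := norm_integral_le_of_norm_le_const (μ := μ) (f := fun η => f ω - f η) (C := ∑' y, v y)
    (Filter.Eventually.of_forall fun η => by
      rw [Real.norm_eq_abs]; exact hf.abs_sub_le_tsum ω η)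
  simpa using this

variable [Countable ι] [Finite S] [MeasurableSpace S] [DiscreteMeasurableSpace S]

theorem exists_bound (μ : Measure (ι → S)) [IsProbabilityMeasure μ] (hf : HasOsc f v) :
    ∃ K, ∀ ω, |f ω| ≤ K :=
  ⟨|∫ η, f η ∂μ| + ∑' y, v y, fun ω => by
    have h1 := hf.abs_sub_integral_le μ ω
    have h2 := abs_add_le (∫ η, f η ∂μ) (f ω - ∫ η, f η ∂μ)
    rw [add_sub_cancel] at h2
    linarith⟩

theorem integrable_mul_exp (μ : Measure (ι → S)) [IsProbabilityMeasure μ] {g : (ι → S) → ℝ}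
    {w : ι → ℝ} (hf : HasOsc f v) (hg : HasOsc g w) (θ : ℝ) :
    Integrable (fun ω => g ω * Real.exp (θ * f ω)) μ := by
  obtain ⟨K, hK⟩ := hf.exists_bound μ
  refine (hg.integrable μ).mul_bdd (c := Real.exp (|θ| * K))
    ((hf.measurable.const_mul θ).exp.aestronglyMeasurable) (Filter.Eventually.of_forall fun ω => ?_)
  rw [Real.norm_eq_abs, Real.abs_exp]
  refine Real.exp_le_exp.2 ((le_abs_self _).trans ?_)
  rw [abs_mul]
  exact mul_le_mul_of_nonneg_left (hK ω) (abs_nonneg _)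

theorem integrable_exp (μ : Measure (ι → S)) [IsProbabilityMeasure μ] (hf : HasOsc f v) (θ : ℝ) :
    Integrable (fun ω => Real.exp (θ * f ω)) μ := by
  simpa using hf.integrable_mul_exp μ (const 1) θ

end HasOsc

/-! ### Single-site updates under Dobrushin's condition -/

/-- The heat-bath update at the site `x`: the coordinate at `x` is resampled from the single-site
distribution `γ x`. -/
def heatBath {ι S : Type*} [DecidableEq ι] [Fintype S] (γ : ι → S → (ι → S) → ℝ) (x : ι)
    (f : (ι → S) → ℝ) (ω : ι → S) : ℝ :=
  ∑ s, γ x s ω * f (Function.update ω x s)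

/-- The effect of a heat-bath update at `x` on an oscillation vector: the oscillation at `x` is
removed and redistributed among the sites in the proportions `C x`. -/
def topple {ι : Type*} [DecidableEq ι] (C : ι → ι → ℝ) (x : ι) (v : ι → ℝ) (y : ι) : ℝ :=
  Function.update v x 0 y + v x * C x y

/-- Single-site distributions `γ x` whose events have oscillations bounded by the rows of the
interdependence matrix `C`, the row sums of `C` being at most `c`, together with a measure `μ`
which is invariant under all single-site updates. -/
structure IsDobrushinSystem {ι S : Type*} [DecidableEq ι] [Fintype S] [MeasurableSpace S]
    (γ : ι → S → (ι → S) → ℝ) (C : ι → ι → ℝ) (c : ℝ) (μ : Measure (ι → S)) : Prop where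
  nonneg : ∀ x s ω, 0 ≤ γ x s ω
  sum_eq_one : ∀ x ω, ∑ s, γ x s ω = 1
  update_eq : ∀ x s ω t, γ x s (Function.update ω x t) = γ x s ω
  hasOsc : ∀ x (A : Finset S), HasOsc (fun ω => ∑ s ∈ A, γ x s ω) (C x)
  row_sum_le : ∀ x, ∑' y, C x y ≤ c
  invariant : ∀ x (f : (ι → S) → ℝ), Measurable f → (∃ K, ∀ ω, |f ω| ≤ K) →
    ∫ ω, heatBath γ x f ω ∂μ = ∫ ω, f ω ∂μ

namespace IsDobrushinSystem

variable {ι S : Type*} [DecidableEq ι] [Fintype S] [MeasurableSpace S]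
  {γ : ι → S → (ι → S) → ℝ} {C : ι → ι → ℝ} {c : ℝ} {μ : Measure (ι → S)}

theorem topple_nonneg (h : IsDobrushinSystem γ C c μ) (x : ι) {v : ι → ℝ} (hv : ∀ y, 0 ≤ v y)
    (y : ι) : 0 ≤ topple C x v y := by
  have h1 := mul_nonneg (hv x) ((h.hasOsc x ∅).nonneg y)
  by_cases hy : y = x
  · subst hy; simpa [topple] using h1
  · simpa [topple, hy] using add_nonneg (hv y) h1

theorem le_topple (h : IsDobrushinSystem γ C c μ) {x y : ι} (hxy : y ≠ x) {v : ι → ℝ}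
    (hv : ∀ y, 0 ≤ v y) : v y ≤ topple C x v y := by
  have h1 := mul_nonneg (hv x) ((h.hasOsc x ∅).nonneg y)
  simpa [topple, hxy] using h1

theorem summable_topple (h : IsDobrushinSystem γ C c μ) (x : ι) {v : ι → ℝ} (hv : Summable v) :
    Summable (topple C x v) :=
  (hv.update x 0).add ((h.hasOsc x ∅).summable.mul_left _)

/-- A toppling at `x` destroys at least the fraction `1 - c` of the mass at `x`. -/
theorem tsum_topple_le (h : IsDobrushinSystem γ C c μ) (x : ι) {v : ι → ℝ} (hv : Summable v)
    (hv0 : ∀ y, 0 ≤ v y) : ∑' y, topple C x v y ≤ ∑' y, v y - (1 - c) * v x := by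
  have e1 : ∑' y, Function.update v x 0 y = ∑' y, v y - v x := by
    have := (hv.hasSum.update x 0).tsum_eq
    rw [this]; ring
  have e2 : ∑' y, topple C x v y = (∑' y, v y - v x) + v x * ∑' y, C x y := by
    unfold topple
    rw [(hv.update x 0).tsum_add ((h.hasOsc x ∅).summable.mul_left _), e1, tsum_mul_left]
  rw [e2]
  nlinarith [mul_le_mul_of_nonneg_left (h.row_sum_le x) (hv0 x)]

/-- For two configurations, the difference of the updates splits into a part with the same spin at
`x`, where `f` differs through the other sites only, and a part due to the change of the distribution
of that spin, which costs the interdependence `C x` times the oscillation of `f` at `x`. -/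
theorem hasOsc_heatBath (h : IsDobrushinSystem γ C c μ) (x : ι) {f : (ι → S) → ℝ} {v : ι → ℝ}
    (hf : HasOsc f v) : HasOsc (heatBath γ x f) (topple C x v) := by
  have hsum := h.summable_topple x hf.summable
  have one_sided : ∀ ω ω', heatBath γ x f ω - heatBath γ x f ω'
      ≤ ∑' y, {y | ω y ≠ ω' y}.indicator (topple C x v) y := by
    intro ω ω'
    set D := {y | ω y ≠ ω' y} with hD
    have hsu : Summable (Function.update v x 0) := hf.summable.update x 0
    have split : heatBath γ x f ω - heatBath γ x f ω'
        = ∑ s, γ x s ω * (f (Function.update ω x s) - f (Function.update ω' x s))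
          + ∑ s, (γ x s ω - γ x s ω') * f (Function.update ω' x s) := by
      unfold heatBath
      rw [← Finset.sum_sub_distrib, ← Finset.sum_add_distrib]
      exact Finset.sum_congr rfl fun s _ => by ring
    have first : ∑ s, γ x s ω * (f (Function.update ω x s) - f (Function.update ω' x s))
        ≤ ∑' y, D.indicator (Function.update v x 0) y := by
      have hs : ∀ s, f (Function.update ω x s) - f (Function.update ω' x s)
          ≤ ∑' y, D.indicator (Function.update v x 0) y := by
        intro s
        refine (le_abs_self _).trans ((hf.bound _ _).trans (le_of_eq ?_))
        refine tsum_congr fun y => ?_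
        by_cases hy : y = x
        · subst hy; simp [Set.indicator]
        · by_cases hyD : ω y = ω' y <;> simp [Set.indicator, hD, hy, hyD]
      calc _ ≤ ∑ s, γ x s ω * ∑' y, D.indicator (Function.update v x 0) y :=
            Finset.sum_le_sum fun s _ => mul_le_mul_of_nonneg_left (hs s) (h.nonneg x s ω)
        _ = _ := by rw [← Finset.sum_mul, h.sum_eq_one, one_mul]
    have second : ∑ s, (γ x s ω - γ x s ω') * f (Function.update ω' x s)
        ≤ (∑' y, D.indicator (C x) y) * v x :=
      sum_sub_mul_le_of_event_le (by rw [h.sum_eq_one, h.sum_eq_one])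
        (fun A => (h.hasOsc x A).bound ω ω') (hf.nonneg x)
        (fun s t => hf.abs_sub_update_le ω' x s t)
    have hC := (h.hasOsc x ∅).summable
    have total : ∑' y, D.indicator (topple C x v) y
        = ∑' y, D.indicator (Function.update v x 0) y + (∑' y, D.indicator (C x) y) * v x := by
      rw [← tsum_mul_right, ← (hsu.indicator D).tsum_add ((hC.indicator D).mul_right _)]
      refine tsum_congr fun y => ?_
      by_cases hy : y ∈ D
      · simp only [Set.indicator_of_mem hy, topple]; ring
      · simp [Set.indicator_of_notMem hy]
    rw [split, total]
    exact add_le_add first second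
  refine ⟨h.topple_nonneg x hf.nonneg, hsum, fun ω ω' => abs_le'.2 ⟨one_sided ω ω', ?_⟩⟩
  rw [neg_sub]
  simpa only [ne_comm] using one_sided ω' ω

theorem heatBath_update (h : IsDobrushinSystem γ C c μ) (x : ι) (f : (ι → S) → ℝ) (ω : ι → S)
    (s : S) : heatBath γ x f (Function.update ω x s) = heatBath γ x f ω := by
  simp [heatBath, h.update_eq]

variable [Countable ι] [DiscreteMeasurableSpace S] [IsProbabilityMeasure μ]

/-- The defect of one update against `exp (θ f)` is, by invariance, the average of the conditional
covariances at `x`. -/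
theorem integral_sub_heatBath_mul_exp_le (h : IsDobrushinSystem γ C c μ) (x : ι)
    {f g : (ι → S) → ℝ} {a v : ι → ℝ} (hf : HasOsc f a) (hg : HasOsc g v) {θ : ℝ} (hθ : 0 ≤ θ) :
    ∫ ω, (g ω - heatBath γ x g ω) * Real.exp (θ * f ω) ∂μ
      ≤ θ * (v x * a x) * ∫ ω, Real.exp (θ * f ω) ∂μ := by
  obtain ⟨K, hK⟩ := hf.exists_bound μ
  have hPg := h.hasOsc_heatBath x hg
  have hexp : ∀ ω, Real.exp (θ * f ω) ≤ Real.exp (θ * K) := fun ω =>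
    Real.exp_le_exp.2 (mul_le_mul_of_nonneg_left ((le_abs_self _).trans (hK ω)) hθ)
  have mexp : Measurable fun ω => Real.exp (θ * f ω) := (hf.measurable.const_mul θ).exp
  have hb1 : ∃ K, ∀ ω, |(g ω - heatBath γ x g ω) * Real.exp (θ * f ω)| ≤ K := by
    obtain ⟨K1, hK1⟩ := hg.exists_bound μ
    obtain ⟨K2, hK2⟩ := hPg.exists_bound μ
    refine ⟨(K1 + K2) * Real.exp (θ * K), fun ω => ?_⟩
    rw [abs_mul, Real.abs_exp]
    exact mul_le_mul ((abs_sub _ _).trans (add_le_add (hK1 ω) (hK2 ω))) (hexp ω)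
      (Real.exp_pos _).le (add_nonneg ((abs_nonneg _).trans (hK1 ω)) ((abs_nonneg _).trans (hK2 ω)))
  have hb2 : ∃ K, ∀ ω, |Real.exp (θ * f ω)| ≤ K := ⟨Real.exp (θ * K), fun ω => by
    rw [Real.abs_exp]; exact hexp ω⟩
  have mγ : ∀ s, Measurable (γ x s) := fun s => by
    simpa using (h.hasOsc x {s}).measurable
  have mupd : ∀ s, Measurable fun ω : ι → S => Function.update ω x s := fun s =>
    measurable_update_left
  have mhb : ∀ {F : (ι → S) → ℝ}, Measurable F → Measurable (heatBath γ x F) := by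
    intro F hF
    unfold heatBath
    exact Finset.measurable_sum _ fun s _ => (mγ s).mul (hF.comp (mupd s))
  have ihb : ∀ {F : (ι → S) → ℝ}, Measurable F → (∃ K, ∀ ω, |F ω| ≤ K) →
      Integrable (heatBath γ x F) μ := by
    rintro F hF ⟨K, hK⟩
    refine Integrable.of_bound (mhb hF).aestronglyMeasurable K
      (Filter.Eventually.of_forall fun ω => ?_)
    rw [Real.norm_eq_abs]
    calc |heatBath γ x F ω| ≤ ∑ s, |γ x s ω * F (Function.update ω x s)| :=
          Finset.abs_sum_le_sum_abs _ _
      _ ≤ ∑ s, γ x s ω * K := Finset.sum_le_sum fun s _ => by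
          rw [abs_mul, abs_of_nonneg (h.nonneg x s ω)]
          exact mul_le_mul_of_nonneg_left (hK _) (h.nonneg x s ω)
      _ = K := by rw [← Finset.sum_mul, h.sum_eq_one, one_mul]
  have m1 : Measurable fun ω => (g ω - heatBath γ x g ω) * Real.exp (θ * f ω) :=
    (hg.measurable.sub hPg.measurable).mul mexp
  rw [← h.invariant x _ m1 hb1, ← h.invariant x _ mexp hb2, ← integral_const_mul]
  refine integral_mono (ihb m1 hb1) ((ihb mexp hb2).const_mul _) fun ω => ?_
  have key := sum_centered_mul_exp_le (p := fun s => γ x s ω)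
    (g := fun s => g (Function.update ω x s)) (h := fun s => θ * f (Function.update ω x s))
    (v := v x) (w := θ * a x) (fun s => h.nonneg x s ω) (h.sum_eq_one x ω) (hg.nonneg x)
    (fun s t => hg.abs_sub_update_le ω x s t) (fun s t => by
      rw [← mul_sub, abs_mul, abs_of_nonneg hθ]
      exact mul_le_mul_of_nonneg_left (hf.abs_sub_update_le ω x s t) hθ)
  have e : v x * (θ * a x) = θ * (v x * a x) := by ring
  rw [e] at key
  dsimp only
  nth_rewrite 1 [heatBath]
  simp only [h.heatBath_update]
  exact key

end IsDobrushinSystem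

/-! ### Gaussian concentration under Dobrushin's condition -/

namespace IsDobrushinSystem

variable {ι S : Type*} [DecidableEq ι] [Fintype S] [MeasurableSpace S]
  {γ : ι → S → (ι → S) → ℝ} {C : ι → ι → ℝ} {c : ℝ} {μ : Measure (ι → S)}

/-- Toppling the sites of a finite set `V` one after the other removes at least the fraction `1 - c`
of the mass which `v` gives to `V`: a site only gains mass until its turn comes. -/
theorem exists_sweep (h : IsDobrushinSystem γ C c μ) (hc : c < 1)
    {Q : ((ι → S) → ℝ) → (ι → ℝ) → Prop} (hosc : ∀ g v, Q g v → HasOsc g v)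
    (hstep : ∀ g v x, Q g v → Q (heatBath γ x g) (topple C x v))
    {g : (ι → S) → ℝ} {v : ι → ℝ} (hQ : Q g v) (V : Finset ι) :
    ∃ g' v', Q g' v' ∧ ∑' y, v' y ≤ ∑' y, v y - (1 - c) * ∑ y ∈ V, v y ∧ ∀ y ∉ V, v y ≤ v' y := by
  induction V using Finset.induction_on with
  | empty => exact ⟨g, v, hQ, by simp, fun _ _ => le_rfl⟩
  | insert x V hx ih =>
    obtain ⟨g', v', hQ', hle, hV⟩ := ih
    have ho := hosc _ _ hQ'
    refine ⟨_, _, hstep g' v' x hQ', ?_, fun y hy => ?_⟩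
    · have h1 := h.tsum_topple_le x ho.summable ho.nonneg
      have h2 := mul_le_mul_of_nonneg_left (hV x hx) (sub_nonneg.2 hc.le)
      rw [Finset.sum_insert hx, mul_add]
      linarith
    · rw [Finset.mem_insert, not_or] at hy
      exact (hV y hy.2).trans (h.le_topple hy.1 ho.nonneg)

/-- Heat-bath updates can make the total oscillation arbitrarily small: sweeping a finite set which
carries at least half of the mass contracts the mass by a fixed factor. The predicate `Q` collects
what is to be remembered along the updates. -/
theorem exists_tsum_lt (h : IsDobrushinSystem γ C c μ) (hc0 : 0 ≤ c) (hc : c < 1)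
    {Q : ((ι → S) → ℝ) → (ι → ℝ) → Prop} (hosc : ∀ g v, Q g v → HasOsc g v)
    (hstep : ∀ g v x, Q g v → Q (heatBath γ x g) (topple C x v))
    {g : (ι → S) → ℝ} {v : ι → ℝ} (hQ : Q g v) {ε : ℝ} (hε : 0 < ε) :
    ∃ g' v', Q g' v' ∧ ∑' y, v' y < ε := by
  set r := 1 - (1 - c) / 2 with hr
  have hr0 : 0 ≤ r := by linarith
  have hr1 : r < 1 := by linarith
  have halve : ∀ g v, Q g v → ∃ g' v', Q g' v' ∧ ∑' y, v' y ≤ r * ∑' y, v y := by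
    intro g v hQ
    have ho := hosc _ _ hQ
    rcases (tsum_nonneg ho.nonneg).eq_or_lt with h0 | hpos
    · exact ⟨g, v, hQ, by rw [← h0, mul_zero]⟩
    obtain ⟨V, hV⟩ : ∃ V : Finset ι, (∑' y, v y) / 2 < ∑ y ∈ V, v y :=
      (ho.summable.hasSum.eventually (lt_mem_nhds (half_lt_self hpos))).exists
    obtain ⟨g', v', hQ', hle, -⟩ := h.exists_sweep hc hosc hstep hQ V
    refine ⟨g', v', hQ', hle.trans ?_⟩
    have := mul_le_mul_of_nonneg_left hV.le (sub_nonneg.2 hc.le)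
    rw [hr]; linarith
  have iter : ∀ n : ℕ, ∃ g' v', Q g' v' ∧ ∑' y, v' y ≤ r ^ n * ∑' y, v y := by
    intro n
    induction n with
    | zero => exact ⟨g, v, hQ, by simp⟩
    | succ n ih =>
      obtain ⟨g', v', hQ', hle⟩ := ih
      obtain ⟨g'', v'', hQ'', hle'⟩ := halve g' v' hQ'
      refine ⟨g'', v'', hQ'', hle'.trans ?_⟩
      rw [pow_succ', mul_assoc]
      exact mul_le_mul_of_nonneg_left hle hr0
  have lim : Filter.Tendsto (fun n : ℕ => r ^ n * ∑' y, v y) Filter.atTop (nhds 0) := by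
    simpa using (tendsto_pow_atTop_nhds_zero_of_lt_one hr0 hr1).mul_const (∑' y, v y)
  obtain ⟨n, hn⟩ := (lim.eventually (gt_mem_nhds hε)).exists
  obtain ⟨g', v', hQ', hle⟩ := iter n
  exact ⟨g', v', hQ', hle.trans_lt hn⟩

variable [Countable ι] [DiscreteMeasurableSpace S] [IsProbabilityMeasure μ]

/-- For `f` centered, this says that the derivative at `θ` of the moment generating function is at
most `θ * B` times its value, with `B = A * (∑ a) / (1 - c)`. An update at a site which carries the
oscillation `v x` costs at most `θ * A * v x` and lowers the total oscillation by at least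
`(1 - c) * v x`, so all updates together cost at most `θ * A * (∑ a) / (1 - c)`. -/
theorem integral_centered_mul_exp_le (h : IsDobrushinSystem γ C c μ) (hc0 : 0 ≤ c) (hc : c < 1)
    {f : (ι → S) → ℝ} {a : ι → ℝ} (hf : HasOsc f a) {A : ℝ} (hA : ∀ x, a x ≤ A)
    {θ : ℝ} (hθ : 0 ≤ θ) :
    ∫ ω, (f ω - ∫ η, f η ∂μ) * Real.exp (θ * f ω) ∂μ
      ≤ θ * (A * (∑' y, a y) / (1 - c)) * ∫ ω, Real.exp (θ * f ω) ∂μ := by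
  set E := ∫ ω, Real.exp (θ * f ω) ∂μ with hE
  have hE0 : 0 ≤ E := integral_nonneg fun _ => (Real.exp_pos _).le
  have hc' : 0 < 1 - c := sub_pos.2 hc
  -- `Q g v`: the function `g` comes from `f` by updates, has oscillations at most `v`, and the cost
  -- of passing from `f` to `g` is paid for by the loss of total oscillation from `a` to `v`.
  let Q : ((ι → S) → ℝ) → (ι → ℝ) → Prop := fun g v => HasOsc g v ∧ ∫ ω, g ω ∂μ = ∫ ω, f ω ∂μ ∧
    ∫ ω, (f ω - g ω) * Real.exp (θ * f ω) ∂μ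
      ≤ θ * (A * (∑' y, a y - ∑' y, v y) / (1 - c)) * E
  have hstep : ∀ g v x, Q g v → Q (heatBath γ x g) (topple C x v) := by
    rintro g v x ⟨hg, hmean, hcost⟩
    have hPg := h.hasOsc_heatBath x hg
    refine ⟨hPg, (h.invariant x g hg.measurable (hg.exists_bound μ)).trans hmean, ?_⟩
    have hint := fun {g : (ι → S) → ℝ} {v : ι → ℝ} (hg : HasOsc g v) =>
      hf.integrable_mul_exp μ hg θ
    have split : ∫ ω, (f ω - heatBath γ x g ω) * Real.exp (θ * f ω) ∂μ
        = ∫ ω, (f ω - g ω) * Real.exp (θ * f ω) ∂μ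
          + ∫ ω, (g ω - heatBath γ x g ω) * Real.exp (θ * f ω) ∂μ := by
      rw [← integral_add]
      · exact integral_congr_ae (Filter.Eventually.of_forall fun ω => by dsimp only; ring)
      · simp only [sub_mul]; exact (hint hf).sub (hint hg)
      · simp only [sub_mul]; exact (hint hg).sub (hint hPg)
    have h1 := h.integral_sub_heatBath_mul_exp_le x hf hg hθ
    have h2 := h.tsum_topple_le x hg.summable hg.nonneg
    have hA0 : 0 ≤ A := (hf.nonneg x).trans (hA x)
    have h3 : v x * a x ≤ A * (∑' y, v y - ∑' y, topple C x v y) / (1 - c) := by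
      rw [le_div_iff₀ hc']
      calc v x * a x * (1 - c) ≤ v x * A * (1 - c) := by
            gcongr
            · exact hg.nonneg x
            · exact hA x
        _ = A * ((1 - c) * v x) := by ring
        _ ≤ _ := mul_le_mul_of_nonneg_left (by linarith) hA0
    have h4 : θ * (v x * a x) * E
        ≤ θ * (A * (∑' y, v y - ∑' y, topple C x v y) / (1 - c)) * E := by gcongr
    rw [split]
    calc _ ≤ θ * (A * (∑' y, a y - ∑' y, v y) / (1 - c)) * E
          + θ * (A * (∑' y, v y - ∑' y, topple C x v y) / (1 - c)) * E :=
          add_le_add hcost (h1.trans h4)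
      _ = _ := by ring
  have hQ0 : Q f a := ⟨hf, rfl, by simp⟩
  refine le_of_forall_pos_le_add fun ε hε => ?_
  obtain ⟨g, v, ⟨hg, hmean, hcost⟩, hlt⟩ := h.exists_tsum_lt hc0 hc (fun g v hQ => hQ.1) hstep hQ0
    (div_pos hε (by linarith : (0 : ℝ) < E + 1))
  have hint := fun {g : (ι → S) → ℝ} {v : ι → ℝ} (hg : HasOsc g v) => hf.integrable_mul_exp μ hg θ
  have split : ∫ ω, (f ω - ∫ η, f η ∂μ) * Real.exp (θ * f ω) ∂μ
      = ∫ ω, (f ω - g ω) * Real.exp (θ * f ω) ∂μ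
        + ∫ ω, (g ω - ∫ η, f η ∂μ) * Real.exp (θ * f ω) ∂μ := by
    rw [← integral_add]
    · exact integral_congr_ae (Filter.Eventually.of_forall fun ω => by dsimp only; ring)
    · simp only [sub_mul]; exact (hint hf).sub (hint hg)
    · simp only [sub_mul]; exact (hint hg).sub (hint (HasOsc.const (∫ η, f η ∂μ)))
  have rest : ∫ ω, (g ω - ∫ η, f η ∂μ) * Real.exp (θ * f ω) ∂μ ≤ ε := by
    calc _ ≤ ∫ ω, (ε / (E + 1)) * Real.exp (θ * f ω) ∂μ := by
          refine integral_mono ?_ ((hf.integrable_exp μ θ).const_mul _) fun ω => ?_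
          · simp only [sub_mul]; exact (hint hg).sub (hint (HasOsc.const (∫ η, f η ∂μ)))
          · refine mul_le_mul_of_nonneg_right ?_ (Real.exp_pos _).le
            rw [← hmean]
            exact (le_abs_self _).trans ((hg.abs_sub_integral_le μ ω).trans hlt.le)
      _ = ε / (E + 1) * E := integral_const_mul _ _
      _ ≤ ε := by
          rw [div_mul_eq_mul_div, div_le_iff₀ (by linarith)]
          nlinarith
  have hA0 : 0 ≤ θ * (A * (∑' y, v y) / (1 - c)) * E := by
    rcases isEmpty_or_nonempty ι with he | ⟨⟨x⟩⟩
    · simp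
    · have := (hf.nonneg x).trans (hA x)
      have : 0 ≤ ∑' y, v y := tsum_nonneg hg.nonneg
      positivity
  have hcost' : θ * (A * (∑' y, a y - ∑' y, v y) / (1 - c)) * E
      = θ * (A * (∑' y, a y) / (1 - c)) * E - θ * (A * (∑' y, v y) / (1 - c)) * E := by ring
  rw [split]
  linarith

/-- By the differential inequality, `mgf f μ θ * exp (-B θ² / 2)` is nonincreasing on `[0, ∞)`. -/
theorem mgf_le (h : IsDobrushinSystem γ C c μ) (hc0 : 0 ≤ c) (hc : c < 1)
    {f : (ι → S) → ℝ} {a : ι → ℝ} (hf : HasOsc f a) (hmean : ∫ ω, f ω ∂μ = 0)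
    {A : ℝ} (hA : ∀ x, a x ≤ A) {θ : ℝ} (hθ : 0 ≤ θ) :
    ProbabilityTheory.mgf f μ θ ≤ Real.exp (A * (∑' y, a y) / (1 - c) * θ ^ 2 / 2) := by
  set B := A * (∑' y, a y) / (1 - c) with hB
  have huniv : ProbabilityTheory.integrableExpSet f μ = Set.univ :=
    Set.eq_univ_of_forall fun t => hf.integrable_exp μ t
  have hd : ∀ t, HasDerivAt (ProbabilityTheory.mgf f μ)
      (∫ ω, f ω * Real.exp (t * f ω) ∂μ) t := fun t =>
    ProbabilityTheory.hasDerivAt_mgf (by rw [huniv, interior_univ]; trivial)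
  have hψ : ∀ t, HasDerivAt
      (fun t => ProbabilityTheory.mgf f μ t * Real.exp (-(B * t ^ 2 / 2)))
      ((∫ ω, f ω * Real.exp (t * f ω) ∂μ) * Real.exp (-(B * t ^ 2 / 2))
        + ProbabilityTheory.mgf f μ t * (Real.exp (-(B * t ^ 2 / 2)) * -(B * t))) t := by
    intro t
    refine (hd t).mul (HasDerivAt.exp ?_)
    have := (((hasDerivAt_pow 2 t).const_mul B).div_const 2).neg
    refine (this.congr_deriv ?_).congr_of_eventuallyEq ?_
    · push_cast; ring
    · exact Filter.Eventually.of_forall fun _ => rfl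
  have anti : AntitoneOn (fun t => ProbabilityTheory.mgf f μ t * Real.exp (-(B * t ^ 2 / 2)))
      (Set.Ici 0) := by
    refine antitoneOn_of_deriv_nonpos (convex_Ici 0)
      (fun t _ => (hψ t).continuousAt.continuousWithinAt)
      (fun t _ => (hψ t).differentiableAt.differentiableWithinAt) fun t ht => ?_
    rw [interior_Ici] at ht
    rw [(hψ t).deriv]
    have key := h.integral_centered_mul_exp_le hc0 hc hf hA (le_of_lt ht)
    rw [hmean] at key
    simp only [sub_zero] at key
    have key' : ∫ ω, f ω * Real.exp (t * f ω) ∂μ ≤ t * B * ProbabilityTheory.mgf f μ t := key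
    nlinarith [mul_le_mul_of_nonneg_right key' (Real.exp_pos (-(B * t ^ 2 / 2))).le]
  have := anti (Set.mem_Ici.2 le_rfl) (Set.mem_Ici.2 hθ) hθ
  simp only [ProbabilityTheory.mgf_zero, ne_eq, OfNat.ofNat_ne_zero, not_false_eq_true, zero_pow,
    mul_zero, zero_div, neg_zero, Real.exp_zero, mul_one] at this
  rw [Real.exp_neg, ← div_eq_mul_inv, div_le_iff₀ (Real.exp_pos _), one_mul] at this
  exact this

/-- Gaussian concentration under Dobrushin's condition. The variance proxy is the product of a bound
on the largest oscillation and the sum of all oscillations, divided by `1 - c`. -/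
theorem measureReal_abs_ge_le (h : IsDobrushinSystem γ C c μ) (hc0 : 0 ≤ c) (hc : c < 1)
    {f : (ι → S) → ℝ} {a : ι → ℝ} (hf : HasOsc f a) {A : ℝ} (hA0 : 0 ≤ A) (hA : ∀ x, a x ≤ A)
    {u : ℝ} (hu : 0 ≤ u) :
    μ.real {ω | u ≤ |f ω - ∫ η, f η ∂μ|}
      ≤ 2 * Real.exp (-u ^ 2 / (2 * (A * (∑' y, a y) / (1 - c)))) := by
  set B := A * (∑' y, a y) / (1 - c) with hB
  have hB0 : 0 ≤ B :=
    div_nonneg (mul_nonneg hA0 (tsum_nonneg hf.nonneg)) (sub_nonneg.2 hc.le)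
  set X := fun ω => f ω - ∫ η, f η ∂μ with hX
  have hXosc : HasOsc X a :=
    ⟨hf.nonneg, hf.summable, fun ω ω' => by simpa [hX] using hf.bound ω ω'⟩
  have hXmean : ∫ ω, X ω ∂μ = 0 := by
    rw [hX, integral_sub (hf.integrable μ) (integrable_const _)]; simp
  have hsub : ProbabilityTheory.HasSubgaussianMGF X ⟨B, hB0⟩ μ := by
    refine ⟨fun t => hXosc.integrable_exp μ t, fun t => ?_⟩
    rcases le_total 0 t with ht | ht
    · exact h.mgf_le hc0 hc hXosc hXmean hA ht
    · have := h.mgf_le hc0 hc hXosc.neg (by rw [integral_neg, hXmean, neg_zero]) hA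
        (neg_nonneg.2 ht)
      rw [neg_sq, show ProbabilityTheory.mgf (fun ω => -X ω) μ (-t) = ProbabilityTheory.mgf X μ t by
        simp [ProbabilityTheory.mgf]] at this
      exact this
  have h1 := hsub.measure_ge_le hu
  have h2 := hsub.neg.measure_ge_le hu
  have hset : {ω | u ≤ |X ω|} = {ω | u ≤ X ω} ∪ {ω | u ≤ (-X) ω} := by
    ext ω; simp [le_abs]
  rw [hset]
  refine (measureReal_union_le _ _).trans ?_
  rw [two_mul]
  exact add_le_add h1 h2

end IsDobrushinSystem

namespace LatticeGibbs

variable {d : ℕ} {S : Type*}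

/-! ### Quasilocality of the single-site distributions -/

theorem shift_neg_apply (x : Site d) (ω : Config d S) (y : Site d) : shift (-x) ω y = ω (y + x) := by
  simp [shift]

theorem shift_shift_neg (x : Site d) (ω : Config d S) : shift x (shift (-x) ω) = ω := by
  ext y; simp [shift]

theorem shift_neg_update (x : Site d) (ω : Config d S) (s : S) :
    shift (-x) (Function.update ω x s) = Function.update (shift (-x) ω) 0 s := by
  ext y
  simp [shift_neg_apply, Function.update_apply]

theorem glue_singleton (x : Site d) (ω : Config d S) (s : S) :
    glue {x} (fun _ => s) ω = Function.update ω x s := by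
  ext y
  simp [glue, Function.update_apply]

/-- The energy `∑_{Λ ∋ 0} Φ(Λ, ω)` of the interactions which involve the origin. -/
noncomputable def originEnergy (Φ : Finset (Site d) → Config d S → ℝ) (ω : Config d S) : ℝ :=
  ∑' Λ : {Λ : Finset (Site d) // (0 : Site d) ∈ Λ}, Φ Λ.1 ω

/-- The single-site distribution `γ_{x}(s | ω)` at `x`, as a function of a spin `s : S` in place of a
configuration on the singleton `{x}`. -/
noncomputable def siteProb [Fintype S] (Φ : Finset (Site d) → Config d S → ℝ) (x : Site d) (s : S)
    (ω : Config d S) : ℝ :=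
  specification Φ {x} (fun _ => s) ω

theorem sum_siteSpins [Fintype S] {M : Type*} [AddCommMonoid M] (x : Site d)
    (F : (({x} : Finset (Site d)) → S) → M) : ∑ σ, F σ = ∑ s, F (fun _ => s) :=
  ((Equiv.funUnique ({x} : Finset (Site d)) S).symm.sum_comp F).symm

theorem partitionFunction_pos [Fintype S] [Nonempty S] (Φ : Finset (Site d) → Config d S → ℝ)
    (Λ : Finset (Site d)) (ω : Config d S) : 0 < partitionFunction Φ Λ ω :=
  Finset.sum_pos (fun _ _ => Real.exp_pos _) Finset.univ_nonempty

theorem siteProb_nonneg [Fintype S] [Nonempty S] (Φ : Finset (Site d) → Config d S → ℝ)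
    (x : Site d) (s : S) (ω : Config d S) : 0 ≤ siteProb Φ x s ω :=
  div_nonneg (Real.exp_pos _).le (partitionFunction_pos Φ {x} ω).le

theorem sum_siteProb [Fintype S] [Nonempty S] (Φ : Finset (Site d) → Config d S → ℝ)
    (x : Site d) (ω : Config d S) : ∑ s, siteProb Φ x s ω = 1 := by
  unfold siteProb
  rw [← sum_siteSpins x (fun σ => specification Φ {x} σ ω)]
  unfold specification
  rw [← Finset.sum_div]
  exact div_self (partitionFunction_pos Φ {x} ω).ne'

/-- The single-site distribution at `x` does not depend on the coordinate at `x`. -/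
theorem siteProb_update [Fintype S] (Φ : Finset (Site d) → Config d S → ℝ)
    (x : Site d) (s : S) (ω : Config d S) (t : S) :
    siteProb Φ x s (Function.update ω x t) = siteProb Φ x s ω := by
  unfold siteProb specification partitionFunction
  simp [sum_siteSpins, hamiltonian, glue_singleton]

theorem abs_sum_siteProb_sub_le_uniformDist [Fintype S] (Φ : Finset (Site d) → Config d S → ℝ)
    (x : Site d) (A : Finset S) (ω ω' : Config d S) :
    |∑ s ∈ A, siteProb Φ x s ω - ∑ s ∈ A, siteProb Φ x s ω'|
      ≤ uniformDist (fun σ => specification Φ {x} σ ω) (fun σ => specification Φ {x} σ ω') := by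
  classical
  have := le_ciSup (f := fun B : Finset (({x} : Finset (Site d)) → S) =>
    |∑ σ ∈ B, specification Φ {x} σ ω - ∑ σ ∈ B, specification Φ {x} σ ω'|)
    (Set.finite_range _).bddAbove
    (A.map (Equiv.funUnique ({x} : Finset (Site d)) S).symm.toEmbedding)
  simpa [Finset.sum_map, uniformDist, siteProb] using! this

theorem uniformDist_le_one [Fintype S] [Nonempty S] (Φ : Finset (Site d) → Config d S → ℝ)
    (x : Site d) (ω ω' : Config d S) :
    uniformDist (fun σ => specification Φ {x} σ ω) (fun σ => specification Φ {x} σ ω') ≤ 1 := by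
  have h0 : ∀ ω σ, 0 ≤ specification Φ {x} σ ω := fun ω σ =>
    div_nonneg (Real.exp_pos _).le (partitionFunction_pos Φ {x} ω).le
  have h1 : ∀ ω, ∑ σ, specification Φ {x} σ ω = 1 := fun ω => by
    unfold specification
    rw [← Finset.sum_div]
    exact div_self (partitionFunction_pos Φ {x} ω).ne'
  have h2 : ∀ ω (A : Finset (({x} : Finset (Site d)) → S)),
      0 ≤ ∑ σ ∈ A, specification Φ {x} σ ω ∧ ∑ σ ∈ A, specification Φ {x} σ ω ≤ 1 :=
    fun ω A => ⟨Finset.sum_nonneg fun σ _ => h0 ω σ, by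
      rw [← h1 ω]
      exact Finset.sum_le_sum_of_subset_of_nonneg (Finset.subset_univ _) fun σ _ _ => h0 ω σ⟩
  refine ciSup_le fun A => abs_le.2 ⟨?_, ?_⟩
  · linarith [(h2 ω A).1, (h2 ω' A).2]
  · linarith [(h2 ω A).2, (h2 ω' A).1]

theorem dobrushinMatrix_nonneg [Fintype S] (Φ : Finset (Site d) → Config d S → ℝ) (x y : Site d) :
    0 ≤ dobrushinMatrix Φ x y :=
  Real.iSup_nonneg fun _ => Real.iSup_nonneg fun _ => abs_nonneg _

theorem abs_sum_siteProb_sub_le_dobrushinMatrix [Fintype S] [Nonempty S]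
    (Φ : Finset (Site d) → Config d S → ℝ) (x y : Site d) (A : Finset S) (ω ω' : Config d S)
    (h : ∀ z, z ≠ y → ω z = ω' z) :
    |∑ s ∈ A, siteProb Φ x s ω - ∑ s ∈ A, siteProb Φ x s ω'| ≤ dobrushinMatrix Φ x y := by
  refine (abs_sum_siteProb_sub_le_uniformDist Φ x A ω ω').trans ?_
  exact le_ciSup (f := fun p : {p : Config d S × Config d S // ∀ z, z ≠ y → p.1 z = p.2 z} =>
    uniformDist (fun σ => specification Φ {x} σ p.1.1) (fun σ => specification Φ {x} σ p.1.2))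
    ⟨1, by rintro _ ⟨p, rfl⟩; exact uniformDist_le_one Φ x _ _⟩ ⟨(ω, ω'), h⟩

theorem summable_dobrushinMatrix [Fintype S] {Φ : Finset (Site d) → Config d S → ℝ}
    (h : dobrushinCoeff Φ < 1) : Summable fun y => dobrushinMatrix Φ 0 y := by
  have := ENNReal.summable_toReal (h.trans ENNReal.one_lt_top).ne
  simpa [ENNReal.toReal_ofReal, dobrushinMatrix_nonneg] using this

theorem tsum_dobrushinMatrix [Fintype S] (Φ : Finset (Site d) → Config d S → ℝ) :
    ∑' y, dobrushinMatrix Φ 0 y = (dobrushinCoeff Φ).toReal := by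
  unfold dobrushinCoeff
  rw [ENNReal.tsum_toReal_eq fun _ => ENNReal.ofReal_ne_top]
  simp [ENNReal.toReal_ofReal, dobrushinMatrix_nonneg]

namespace IsUniformlySummablePotential

variable [MeasurableSpace S] {Φ : Finset (Site d) → Config d S → ℝ}

theorem eq_of_eqOn [MeasurableSingletonClass S]
    (hΦ : IsUniformlySummablePotential Φ) (Λ : Finset (Site d)) {ω ω' : Config d S}
    (h : ∀ x ∈ Λ, ω x = ω' x) : Φ Λ ω = Φ Λ ω' := by
  have hle : cylinderEvents (X := fun _ : Site d => S) (Λ : Set (Site d))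
      ≤ Filtration.piFinset (X := fun _ : Site d => S) Λ := by
    rw [Filtration.piFinset_eq_comap_restrict]
    refine iSup₂_le fun x hx => ?_
    have hx' : Measurable fun τ : Λ → S => τ ⟨x, hx⟩ := measurable_pi_apply _
    rw [← measurable_iff_comap_le]
    exact hx'.comp (comap_measurable _)
  exact ((hΦ.measurable Λ).mono hle le_rfl).dependsOn_of_piFinset h

theorem abs_le_iSup [MeasurableSingletonClass S] [Finite S]
    (hΦ : IsUniformlySummablePotential Φ) (Λ : Finset (Site d)) (ω : Config d S) :
    |Φ Λ ω| ≤ ⨆ η : Config d S, |Φ Λ η| := by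
  have hfin : (Set.range fun η : Config d S => |Φ Λ η|).Finite := by
    refine (Set.finite_range fun τ : Λ → S => |Φ Λ (glue Λ τ ω)|).subset ?_
    rintro _ ⟨η, rfl⟩
    refine ⟨fun x => η x, ?_⟩
    dsimp only
    rw [hΦ.eq_of_eqOn Λ (ω := glue Λ (fun x => η x) ω) (ω' := η) fun x hx => by simp [glue, hx]]
  exact le_ciSup hfin.bddAbove ω

/-- Translating `x` to the origin maps the sets meeting `{x}` onto those containing `0`. -/
theorem hamiltonian_singleton (hΦ : IsUniformlySummablePotential Φ) (x : Site d) (s : S)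
    (ω : Config d S) :
    hamiltonian Φ {x} (fun _ => s) ω
      = originEnergy Φ (Function.update (shift (-x) ω) 0 s) := by
  let e : {Λ : Finset (Site d) // (0 : Site d) ∈ Λ}
      ≃ {Λ : Finset (Site d) // (Λ ∩ {x}).Nonempty} :=
    { toFun := fun Λ => ⟨Λ.1.image fun y => y + x, x, by simpa using Λ.2⟩
      invFun := fun Λ => ⟨Λ.1.image fun y => y - x, by
        obtain ⟨z, hz⟩ := Λ.2
        rw [Finset.mem_inter, Finset.mem_singleton] at hz
        obtain ⟨hz, rfl⟩ := hz
        exact Finset.mem_image.2 ⟨z, hz, sub_self z⟩⟩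
      left_inv := fun Λ => by
        ext y
        simp only [Finset.image_image, Function.comp_def, add_sub_cancel_right, Finset.image_id']
      right_inv := fun Λ => by
        ext y
        simp only [Finset.image_image, Function.comp_def, sub_add_cancel, Finset.image_id'] }
  unfold hamiltonian originEnergy
  rw [← e.tsum_eq]
  refine tsum_congr fun Λ => ?_
  have h := hΦ.shift_invariant Λ.1 x (Function.update (shift (-x) ω) 0 s)
  rw [← shift_neg_update, shift_shift_neg] at h
  rw [glue_singleton, ← shift_neg_update]
  exact h

theorem siteProb_eq [Fintype S] (hΦ : IsUniformlySummablePotential Φ) (x : Site d) (s : S)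
    (ω : Config d S) :
    siteProb Φ x s ω = Real.exp (-originEnergy Φ (Function.update (shift (-x) ω) 0 s))
      / ∑ t, Real.exp (-originEnergy Φ (Function.update (shift (-x) ω) 0 t)) := by
  unfold siteProb specification partitionFunction
  simp only [sum_siteSpins, hΦ.hamiltonian_singleton]

theorem siteProb_eq_shift [Fintype S] (hΦ : IsUniformlySummablePotential Φ) (x : Site d) (s : S)
    (ω : Config d S) : siteProb Φ x s ω = siteProb Φ 0 s (shift (-x) ω) := by
  have h0 : shift (-0) (shift (-x) ω) = shift (-x) ω := by ext y; simp [shift]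
  rw [hΦ.siteProb_eq, hΦ.siteProb_eq, h0]

/-- Quasilocality of the energy, from uniform summability by dominated convergence. -/
theorem tendsto_originEnergy [MeasurableSingletonClass S] [Finite S]
    (hΦ : IsUniformlySummablePotential Φ) {ω : Config d S} {u : Finset (Site d) → Config d S}
    (hu : ∀ V, ∀ x ∈ V, u V x = ω x) :
    Filter.Tendsto (fun V => originEnergy Φ (u V)) Filter.atTop (nhds (originEnergy Φ ω)) := by
  refine tendsto_tsum_of_dominated_convergence hΦ.summable (fun Λ => ?_)
    (Filter.Eventually.of_forall fun V Λ => ?_)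
  · refine tendsto_const_nhds.congr' ?_
    filter_upwards [Filter.eventually_ge_atTop Λ.1] with V hV
    exact (hΦ.eq_of_eqOn Λ.1 fun x hx => hu V x (hV hx)).symm
  · rw [Real.norm_eq_abs]
    exact hΦ.abs_le_iSup Λ.1 (u V)

theorem tendsto_siteProb [MeasurableSingletonClass S] [Fintype S] [Nonempty S]
    (hΦ : IsUniformlySummablePotential Φ) (s : S) {ω : Config d S}
    {u : Finset (Site d) → Config d S} (hu : ∀ V, ∀ x ∈ V, u V x = ω x) :
    Filter.Tendsto (fun V => siteProb Φ 0 s (u V)) Filter.atTop (nhds (siteProb Φ 0 s ω)) := by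
  have hz : ∀ η : Config d S, shift (-0) η = η := fun η => by ext y; simp [shift]
  simp only [hΦ.siteProb_eq, hz]
  have h1 : ∀ t, Filter.Tendsto (fun V => Real.exp (-originEnergy Φ (Function.update (u V) 0 t)))
      Filter.atTop (nhds (Real.exp (-originEnergy Φ (Function.update ω 0 t)))) := by
    intro t
    refine (Real.continuous_exp.tendsto _).comp (hΦ.tendsto_originEnergy ?_).neg
    intro V x hx
    simp only [Function.update_apply, hu V x hx]
  exact (h1 s).div (tendsto_finsetSum _ fun t _ => h1 t)
    (Finset.sum_pos (fun _ _ => Real.exp_pos _) Finset.univ_nonempty).ne'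

/-- Changing the boundary condition site by site and passing to the limit by quasilocality, the
oscillations of the single-site events at the origin are bounded by the Dobrushin matrix. -/
theorem hasOsc_siteProb_zero [MeasurableSingletonClass S] [Fintype S] [Nonempty S]
    (hΦ : IsUniformlySummablePotential Φ) (hDob : dobrushinCoeff Φ < 1) (A : Finset S) :
    HasOsc (fun ω => ∑ s ∈ A, siteProb Φ 0 s ω) (dobrushinMatrix Φ 0) := by
  classical
  refine ⟨dobrushinMatrix_nonneg Φ 0, summable_dobrushinMatrix hDob, fun ω ω' => ?_⟩
  set D := {y | ω y ≠ ω' y} with hD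
  -- `u V` interpolates between `ω` and `ω'`: it equals `ω'` on `V` and `ω` off `V`.
  let u : Finset (Site d) → Config d S := fun V y => if y ∈ V then ω' y else ω y
  have hsum := (summable_dobrushinMatrix hDob).indicator D
  have fin : ∀ V, |∑ s ∈ A, siteProb Φ 0 s ω - ∑ s ∈ A, siteProb Φ 0 s (u V)|
      ≤ ∑ y ∈ V, D.indicator (dobrushinMatrix Φ 0) y := by
    intro V
    induction V using Finset.induction_on with
    | empty => simp [u]
    | insert x V hx ih =>
      rw [Finset.sum_insert hx, add_comm]
      refine (abs_sub_le _ (∑ s ∈ A, siteProb Φ 0 s (u V)) _).trans (add_le_add ih ?_)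
      by_cases hxD : x ∈ D
      · rw [Set.indicator_of_mem hxD]
        refine abs_sum_siteProb_sub_le_dobrushinMatrix Φ 0 x A _ _ fun z hz => ?_
        simp [u, hz]
      · have hxe : ω x = ω' x := not_not.1 hxD
        have : u (insert x V) = u V := by
          ext z
          by_cases hz : z = x
          · subst hz; simp [u, hxe]
          · simp [u, hz]
        rw [this, sub_self, abs_zero]
        exact Set.indicator_nonneg (fun y _ => dobrushinMatrix_nonneg Φ 0 y) x
  have lim : Filter.Tendsto
      (fun V => |∑ s ∈ A, siteProb Φ 0 s ω - ∑ s ∈ A, siteProb Φ 0 s (u V)|) Filter.atTop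
      (nhds |∑ s ∈ A, siteProb Φ 0 s ω - ∑ s ∈ A, siteProb Φ 0 s ω'|) :=
    (tendsto_const_nhds.sub (tendsto_finsetSum _ fun s _ =>
      hΦ.tendsto_siteProb s fun V x hx => by simp [u, hx])).abs
  refine le_of_tendsto lim (Filter.Eventually.of_forall fun V => (fin V).trans ?_)
  exact hsum.sum_le_tsum V fun y _ =>
    Set.indicator_nonneg (fun y _ => dobrushinMatrix_nonneg Φ 0 y) y

theorem hasOsc_siteProb [MeasurableSingletonClass S] [Fintype S] [Nonempty S]
    (hΦ : IsUniformlySummablePotential Φ) (hDob : dobrushinCoeff Φ < 1) (x : Site d)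
    (A : Finset S) :
    HasOsc (fun ω => ∑ s ∈ A, siteProb Φ x s ω) (fun y => dobrushinMatrix Φ 0 (y - x)) := by
  have h := (hΦ.hasOsc_siteProb_zero hDob A).comp_equiv (Equiv.addRight x)
  have e : ∀ ω : Config d S, (fun z => ω (z + x)) = shift (-x) ω := fun ω => by
    ext z; simp [shift]
  simp only [Equiv.addRight_symm, Equiv.coe_addRight, ← sub_eq_add_neg] at h
  simpa only [hΦ.siteProb_eq_shift x, ← e] using h

end IsUniformlySummablePotential

/-! ### The DLR equation for one site -/

theorem IsGibbsMeasure.integral_heatBath [Fintype S] [Nonempty S] [MeasurableSpace S]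
    {Φ : Finset (Site d) → Config d S → ℝ} {μ : Measure (Config d S)} (hμ : IsGibbsMeasure Φ μ)
    (x : Site d) (hmeas : ∀ s, Measurable (siteProb Φ x s)) {f : Config d S → ℝ}
    (hf : Measurable f) (hb : ∃ K, ∀ ω, |f ω| ≤ K) :
    ∫ ω, heatBath (siteProb Φ) x f ω ∂μ = ∫ ω, f ω ∂μ := by
  have := hμ.isProbabilityMeasure
  have hupd : ∀ s, Measurable fun ω : Config d S => Function.update ω x s := fun s =>
    measurable_update_left
  have hρ : ∀ s, Measurable fun ω => ENNReal.ofReal (siteProb Φ x s ω) := fun s =>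
    (hmeas s).ennreal_ofReal
  -- The DLR equation says that `μ` is the sum over `s` of its images under `ω ↦ ω^{x ← s}`,
  -- weighted by the single-site probabilities.
  have hdecomp : μ = ∑ s, (μ.withDensity fun ω => ENNReal.ofReal (siteProb Φ x s ω)).map
      fun ω => Function.update ω x s := by
    ext A hA
    rw [hμ.dlr {x} A hA, Measure.finsetSum_apply]
    simp only [sum_siteSpins, glue_singleton]
    rw [lintegral_finsetSum']
    · refine Finset.sum_congr rfl fun s _ => ?_
      rw [Measure.map_apply (hupd s) hA, withDensity_apply _ (hupd s hA),
        ← lintegral_indicator (hupd s hA)]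
      refine lintegral_congr fun ω => ?_
      by_cases h : Function.update ω x s ∈ A
      · simp [Set.indicator, h, siteProb]
      · simp [Set.indicator, h]
    · intro s _
      exact ((hρ s).mul ((measurable_one.indicator hA).comp (hupd s))).aemeasurable
  obtain ⟨K, hK⟩ := hb
  have hmul : ∀ s, Integrable (fun ω => siteProb Φ x s ω * f (Function.update ω x s)) μ := by
    intro s
    refine Integrable.of_bound ((hmeas s).mul (hf.comp (hupd s))).aestronglyMeasurable K
      (Filter.Eventually.of_forall fun ω => ?_)
    rw [Real.norm_eq_abs, abs_mul, abs_of_nonneg (siteProb_nonneg Φ x s ω)]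
    have h1 : siteProb Φ x s ω ≤ 1 := by
      rw [← sum_siteProb Φ x ω]
      exact Finset.single_le_sum (fun t _ => siteProb_nonneg Φ x t ω) (Finset.mem_univ s)
    have := mul_le_mul h1 (hK (Function.update ω x s)) (abs_nonneg _) zero_le_one
    rwa [one_mul] at this
  have hwd : ∀ s, ∫ ω, f ω ∂((μ.withDensity fun ω => ENNReal.ofReal (siteProb Φ x s ω)).map
      fun ω => Function.update ω x s) = ∫ ω, siteProb Φ x s ω * f (Function.update ω x s) ∂μ := by
    intro s
    rw [integral_map (hupd s).aemeasurable hf.aestronglyMeasurable,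
      integral_withDensity_eq_integral_toReal_smul (hρ s)
        (Filter.Eventually.of_forall fun _ => ENNReal.ofReal_lt_top)]
    simp [ENNReal.toReal_ofReal, siteProb_nonneg]
  conv_rhs => rw [hdecomp]
  rw [integral_finsetSum_measure]
  · simp only [hwd, heatBath]
    exact integral_finsetSum _ fun s _ => hmul s
  · intro s _
    rw [integrable_map_measure hf.aestronglyMeasurable (hupd s).aemeasurable,
      integrable_withDensity_iff (hρ s)
        (Filter.Eventually.of_forall fun _ => ENNReal.ofReal_lt_top)]
    simpa [ENNReal.toReal_ofReal, siteProb_nonneg, mul_comm] using hmul s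

/-- The matrix used is `C (x, y) = C (0, y - x)`, which shift invariance allows; its row sums are all
equal to the Dobrushin coefficient. -/
theorem IsGibbsMeasure.isDobrushinSystem [Fintype S] [Nonempty S] [MeasurableSpace S]
    [DiscreteMeasurableSpace S] {Φ : Finset (Site d) → Config d S → ℝ}
    (hΦ : IsUniformlySummablePotential Φ) (hDob : dobrushinCoeff Φ < 1)
    {μ : Measure (Config d S)} (hμ : IsGibbsMeasure Φ μ) :
    IsDobrushinSystem (siteProb Φ) (fun x y => dobrushinMatrix Φ 0 (y - x))
      (dobrushinCoeff Φ).toReal μ where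
  nonneg := siteProb_nonneg Φ
  sum_eq_one := sum_siteProb Φ
  update_eq := siteProb_update Φ
  hasOsc := hΦ.hasOsc_siteProb hDob
  row_sum_le x := by
    rw [← tsum_dobrushinMatrix]
    exact ((Equiv.subRight x).tsum_eq (dobrushinMatrix Φ 0)).le
  invariant x f hf hb := hμ.integral_heatBath x
    (fun s => by simpa using (hΦ.hasOsc_siteProb hDob x {s}).measurable) hf hb

end LatticeGibbs

namespace LatticeGibbs

variable {d : ℕ} {S : Type*}

/-! ### The Kantorovich distance to the empirical measure -/

/-- Since `d * ‖z‖_∞ ≥ ∑ |z_i|`, the terms are dominated by `∏ r ^ |z_i|` with `r ^ d = 1 / 2`, a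
product of convergent geometric series. -/
theorem summable_half_pow_supNorm (d : ℕ) : Summable fun z : Site d => (1 / 2 : ℝ) ^ supNorm z := by
  rcases Nat.eq_zero_or_pos d with rfl | hd
  · exact Summable.of_finite
  set r : ℝ := (1 / 2 : ℝ) ^ (1 / d : ℝ) with hr
  have hd' : (d : ℝ) ≠ 0 := by exact_mod_cast hd.ne'
  have hr0 : 0 < r := Real.rpow_pos_of_pos (by norm_num) _
  have hr1 : r < 1 := Real.rpow_lt_one (by norm_num) (by norm_num) (by positivity)
  have hrd : r ^ d = 1 / 2 := by
    rw [hr, ← Real.rpow_natCast, ← Real.rpow_mul (by norm_num), one_div_mul_cancel hd',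
      Real.rpow_one]
  have hgeo : Summable fun n : ℤ => r ^ n.natAbs := by
    refine Summable.of_nat_of_neg ?_ ?_ <;>
      simpa using summable_geometric_of_lt_one hr0.le hr1
  have hprod : ∀ n : ℕ, Summable fun z : Fin n → ℤ => ∏ i, r ^ (z i).natAbs := by
    intro n
    induction n with
    | zero => exact Summable.of_finite
    | succ n ih =>
      rw [← (Fin.consEquiv fun _ : Fin (n + 1) => ℤ).summable_iff]
      have := hgeo.mul_of_nonneg ih (fun _ => by positivity) (fun _ => by positivity)
      refine this.congr fun p => ?_
      simp [Fin.prod_univ_succ, Fin.consEquiv]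
  refine (hprod d).of_nonneg_of_le (fun _ => by positivity) fun z => ?_
  rw [← hrd, ← pow_mul, Finset.prod_pow_eq_pow_sum]
  refine pow_le_pow_of_le_one hr0.le hr1.le ?_
  calc ∑ i, (z i).natAbs ≤ ∑ _i : Fin d, supNorm z :=
        Finset.sum_le_sum fun i _ => Finset.le_sup (f := fun i => (z i).natAbs) (Finset.mem_univ i)
    _ = d * supNorm z := by simp

theorem configDist_le_tsum (ω ω' : Config d S) :
    configDist ω ω' ≤ ∑' y, {y | ω y ≠ ω' y}.indicator (fun y => (1 / 2 : ℝ) ^ supNorm y) y := by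
  have h0 : ∀ y, 0 ≤ {y | ω y ≠ ω' y}.indicator (fun y => (1 / 2 : ℝ) ^ supNorm y) y := fun y =>
    Set.indicator_nonneg (fun _ _ => by positivity) y
  unfold configDist
  split_ifs with h
  · exact tsum_nonneg h0
  · obtain ⟨x, hx⟩ := Function.ne_iff.1 h
    obtain ⟨y, hy, hk⟩ :=
      Nat.sInf_mem (s := {k : ℕ | ∃ x, ω x ≠ ω' x ∧ supNorm x = k}) ⟨_, x, hx, rfl⟩
    rw [← hk]
    have := ((summable_half_pow_supNorm d).indicator {y | ω y ≠ ω' y}).le_tsum y fun z _ => h0 z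
    rwa [Set.indicator_of_mem (show y ∈ {y | ω y ≠ ω' y} from hy)] at this

theorem hasOsc_of_lipschitz {G : Config d S → ℝ} (hG : ∀ ω η, |G ω - G η| ≤ configDist ω η) :
    HasOsc G fun y => (1 / 2 : ℝ) ^ supNorm y :=
  ⟨fun _ => by positivity, summable_half_pow_supNorm d, fun ω ω' =>
    (hG ω ω').trans (configDist_le_tsum ω ω')⟩

/-- The oscillation at `z` of the average over `x ∈ Λ` of `G ∘ shift x`, for `G` 1-Lipschitz: the
shift by `x` moves the site `z` to `z + x`, where `G` oscillates by at most `2^{-‖z + x‖}`. -/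
noncomputable def empiricalOsc (Λ : Finset (Site d)) (z : Site d) : ℝ :=
  (Λ.card : ℝ)⁻¹ * ∑ x ∈ Λ, (1 / 2 : ℝ) ^ supNorm (z + x)

theorem empiricalOsc_nonneg (Λ : Finset (Site d)) (z : Site d) : 0 ≤ empiricalOsc Λ z := by
  unfold empiricalOsc; positivity

theorem hasSum_empiricalOsc {Λ : Finset (Site d)} (hΛ : Λ.Nonempty) :
    HasSum (empiricalOsc Λ) (∑' z : Site d, (1 / 2 : ℝ) ^ supNorm z) := by
  have h1 : ∀ x ∈ Λ, HasSum (fun z : Site d => (1 / 2 : ℝ) ^ supNorm (z + x))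
      (∑' z : Site d, (1 / 2 : ℝ) ^ supNorm z) := fun x _ =>
    ((Equiv.addRight x).hasSum_iff (f := fun z : Site d => (1 / 2 : ℝ) ^ supNorm z)).2
      (summable_half_pow_supNorm d).hasSum
  have h2 := (hasSum_sum h1).mul_left (Λ.card : ℝ)⁻¹
  have h3 : (Λ.card : ℝ) ≠ 0 := by exact_mod_cast hΛ.card_ne_zero
  rwa [Finset.sum_const, nsmul_eq_mul, inv_mul_cancel_left₀ h3] at h2

/-- The sites `z + x`, `x ∈ Λ`, are distinct, which gains the factor `|Λ|⁻¹` over the total mass. -/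
theorem empiricalOsc_le (Λ : Finset (Site d)) (z : Site d) :
    empiricalOsc Λ z ≤ (Λ.card : ℝ)⁻¹ * ∑' z : Site d, (1 / 2 : ℝ) ^ supNorm z := by
  refine mul_le_mul_of_nonneg_left ?_ (by positivity)
  have h := ((Equiv.addLeft z).summable_iff.2 (summable_half_pow_supNorm d)).sum_le_tsum Λ
    fun _ _ => by simp only [Function.comp_apply]; positivity
  exact h.trans_eq ((Equiv.addLeft z).tsum_eq fun z : Site d => (1 / 2 : ℝ) ^ supNorm z)

variable [MeasurableSpace S]

theorem integral_empiricalMeasure [MeasurableSingletonClass S] (Λ : Finset (Site d))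
    (ω : Config d S) (G : Config d S → ℝ) :
    ∫ η, G η ∂(empiricalMeasure Λ ω) = (Λ.card : ℝ)⁻¹ * ∑ x ∈ Λ, G (shift x ω) := by
  unfold empiricalMeasure
  rw [integral_smul_measure, integral_finsetSum_measure fun x _ => integrable_dirac (by simp)]
  simp

theorem isProbabilityMeasure_empiricalMeasure {Λ : Finset (Site d)} (hΛ : Λ.Nonempty)
    (ω : Config d S) : IsProbabilityMeasure (empiricalMeasure Λ ω) := by
  refine ⟨?_⟩
  simp only [empiricalMeasure, Measure.smul_apply, Measure.finsetSum_apply, measure_univ,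
    Finset.sum_const, nsmul_eq_mul, mul_one, smul_eq_mul]
  exact ENNReal.inv_mul_cancel (by exact_mod_cast hΛ.card_ne_zero) (ENNReal.natCast_ne_top _)

theorem bddAbove_kantorovich [Finite S] [DiscreteMeasurableSpace S] (μ₁ μ₂ : Measure (Config d S))
    [IsProbabilityMeasure μ₁] [IsProbabilityMeasure μ₂] :
    BddAbove (Set.range fun G : {G : Config d S → ℝ // ∀ ω η, |G ω - G η| ≤ configDist ω η} =>
      (∫ ω, G.1 ω ∂μ₁ - ∫ ω, G.1 ω ∂μ₂)) := by
  refine ⟨∑' z : Site d, (1 / 2 : ℝ) ^ supNorm z, ?_⟩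
  rintro _ ⟨G, rfl⟩
  have hG := hasOsc_of_lipschitz G.2
  have h1 : ∫ ω, G.1 ω ∂μ₁ - ∫ ω, G.1 ω ∂μ₂ = ∫ ω, (G.1 ω - ∫ η, G.1 η ∂μ₂) ∂μ₁ := by
    rw [integral_sub (hG.integrable μ₁) (integrable_const _)]; simp
  dsimp only
  rw [h1]
  calc _ ≤ ∫ _ω, (∑' z : Site d, (1 / 2 : ℝ) ^ supNorm z) ∂μ₁ :=
        integral_mono ((hG.integrable μ₁).sub (integrable_const _)) (integrable_const _)
          fun ω => (le_abs_self _).trans (hG.abs_sub_integral_le μ₂ ω)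
    _ = _ := by simp

theorem integral_empiricalMeasure_sub_le [MeasurableSingletonClass S] {Λ : Finset (Site d)}
    {G : Config d S → ℝ} (hG : HasOsc G fun y => (1 / 2 : ℝ) ^ supNorm y) (ω ω' : Config d S) :
    ∫ η, G η ∂(empiricalMeasure Λ ω) - ∫ η, G η ∂(empiricalMeasure Λ ω')
      ≤ ∑' y, {y | ω y ≠ ω' y}.indicator (empiricalOsc Λ) y := by
  set D := {y | ω y ≠ ω' y} with hD
  have hshift : ∀ x, G (shift x ω) - G (shift x ω')
      ≤ ∑' z, D.indicator (fun z => (1 / 2 : ℝ) ^ supNorm (z + x)) z := by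
    intro x
    have h := ((hG.comp_equiv (Equiv.subRight x)).bound ω ω')
    exact (le_abs_self _).trans h
  have hsum : ∀ x ∈ Λ, Summable (D.indicator (fun z : Site d => (1 / 2 : ℝ) ^ supNorm (z + x))) :=
    fun x _ => ((Equiv.addRight x).summable_iff.2 (summable_half_pow_supNorm d)).indicator D
  have htotal : ∑' y, D.indicator (empiricalOsc Λ) y = (Λ.card : ℝ)⁻¹ *
      ∑ x ∈ Λ, ∑' z, D.indicator (fun z => (1 / 2 : ℝ) ^ supNorm (z + x)) z := by
    rw [← Summable.tsum_finsetSum hsum, ← tsum_mul_left]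
    refine tsum_congr fun y => ?_
    by_cases hy : y ∈ D
    · simp only [Set.indicator_of_mem hy, empiricalOsc]
    · simp [Set.indicator_of_notMem hy]
  rw [integral_empiricalMeasure, integral_empiricalMeasure, ← mul_sub, ← Finset.sum_sub_distrib,
    htotal]
  exact mul_le_mul_of_nonneg_left (Finset.sum_le_sum fun x _ => hshift x) (by positivity)

/-- For each 1-Lipschitz `G`, the map `ω ↦ ∫ G d(empiricalMeasure Λ ω)` has oscillations bounded by
`empiricalOsc Λ`, and this common bound passes to the supremum over `G`. -/
theorem hasOsc_kantorovichDist [Finite S] [DiscreteMeasurableSpace S] {Λ : Finset (Site d)}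
    (hΛ : Λ.Nonempty) (μ : Measure (Config d S)) [IsProbabilityMeasure μ] :
    HasOsc (fun ω => kantorovichDist (empiricalMeasure Λ ω) μ) (empiricalOsc Λ) := by
  have := isProbabilityMeasure_empiricalMeasure (S := S) hΛ
  have one_sided : ∀ ω ω', kantorovichDist (empiricalMeasure Λ ω) μ
      ≤ kantorovichDist (empiricalMeasure Λ ω') μ
        + ∑' y, {y | ω y ≠ ω' y}.indicator (empiricalOsc Λ) y := by
    intro ω ω'
    have : Nonempty {G : Config d S → ℝ // ∀ ω η, |G ω - G η| ≤ configDist ω η} :=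
      ⟨fun _ => 0, fun ω η => by
        unfold configDist
        split_ifs <;> simp⟩
    refine ciSup_le fun G => ?_
    have h1 := integral_empiricalMeasure_sub_le (Λ := Λ) (hasOsc_of_lipschitz G.2) ω ω'
    have h2 : ∫ η, G.1 η ∂(empiricalMeasure Λ ω') - ∫ η, G.1 η ∂μ
        ≤ kantorovichDist (empiricalMeasure Λ ω') μ :=
      le_ciSup (bddAbove_kantorovich (empiricalMeasure Λ ω') μ) G
    linarith
  refine ⟨empiricalOsc_nonneg Λ, (hasSum_empiricalOsc hΛ).summable, fun ω ω' => abs_le'.2 ⟨?_, ?_⟩⟩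
  · linarith [one_sided ω ω']
  · have h := one_sided ω' ω
    simp only [ne_comm (a := ω' _)] at h
    linarith

end LatticeGibbs

theorem mainTheorem10 (d : ℕ) (hd : 2 ≤ d)
    (S : Type*) [Fintype S] [MeasurableSpace S] [DiscreteMeasurableSpace S]
    (Φ : Finset (LatticeGibbs.Site d) → LatticeGibbs.Config d S → ℝ)
    (hΦ : LatticeGibbs.IsUniformlySummablePotential Φ)
    (hDob : LatticeGibbs.dobrushinCoeff Φ < 1)
    (μ : Measure (LatticeGibbs.Config d S)) (hμ : LatticeGibbs.IsGibbsMeasure Φ μ)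
    (Λ : Finset (LatticeGibbs.Site d)) (hΛ : Λ.Nonempty) :
    Integrable (fun ω => LatticeGibbs.kantorovichDist (LatticeGibbs.empiricalMeasure Λ ω) μ) μ ∧
    ∀ u : ℝ, 0 < u →
      μ.real {ω | u ≤ |LatticeGibbs.kantorovichDist (LatticeGibbs.empiricalMeasure Λ ω) μ
          - ∫ η, LatticeGibbs.kantorovichDist (LatticeGibbs.empiricalMeasure Λ η) μ ∂μ|}
        ≤ 2 * Real.exp (-((1 - (LatticeGibbs.dobrushinCoeff Φ).toReal) ^ 2
              / (2 * LatticeGibbs.latticeConst d)) * (Λ.card : ℝ) * u ^ 2) := by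
  have := hμ.isProbabilityMeasure
  have hS : Nonempty S := (nonempty_of_isProbabilityMeasure μ).map fun ω => ω 0
  have hF := LatticeGibbs.hasOsc_kantorovichDist hΛ μ
  refine ⟨hF.integrable μ, fun u hu => ?_⟩
  set c := (LatticeGibbs.dobrushinCoeff Φ).toReal with hc
  set K := ∑' z : LatticeGibbs.Site d, (1 / 2 : ℝ) ^ LatticeGibbs.supNorm z with hK
  have hc0 : 0 ≤ c := ENNReal.toReal_nonneg
  have hc1 : c < 1 := by
    rw [hc, ← ENNReal.toReal_one]
    exact (ENNReal.toReal_lt_toReal (hDob.trans ENNReal.one_lt_top).ne ENNReal.one_ne_top).2 hDob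
  have hK0 : 0 < K := (LatticeGibbs.summable_half_pow_supNorm d).tsum_pos
    (fun _ => by positivity) 0 (by positivity)
  have hn : (0 : ℝ) < Λ.card := by exact_mod_cast hΛ.card_pos
  have key := (hμ.isDobrushinSystem hΦ hDob).measureReal_abs_ge_le hc0 hc1 hF
    (A := (Λ.card : ℝ)⁻¹ * K) (by positivity) (LatticeGibbs.empiricalOsc_le Λ) hu.le
  rw [(LatticeGibbs.hasSum_empiricalOsc hΛ).tsum_eq] at key
  refine key.trans ?_
  have hconst : LatticeGibbs.latticeConst d = K ^ 2 := rfl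
  -- `key` has `1 - c` where the claim has the smaller number `(1 - c) ^ 2`.
  have h1 : -u ^ 2 / (2 * ((Λ.card : ℝ)⁻¹ * K * K / (1 - c)))
      = -((1 - c) / (2 * K ^ 2) * Λ.card * u ^ 2) := by
    have : 1 - c ≠ 0 := (sub_pos.2 hc1).ne'
    field_simp
  have h2 : (1 - c) ^ 2 ≤ 1 - c := by nlinarith
  rw [h1, hconst, neg_mul, neg_mul]
  gcongr
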